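/- **Conventions.** A *distance* on a set $X$ is a function $d_X:X\times X\to[0,\infty]$ with $d_X(x,x)=0$, $d_X(x,y)=d_X(y,x)$ and $d_X(x,z)\le d_X(x,y)+d_X(y,z)$; it is an *$\infty$-metric* if $d_X(x,y)>0$ for $x\ne y$, a *pseudometric* if it is finite, a *metric* if it is both. In $[0,\infty]$ we put $0\cdot\infty=0$. An *isometry* is a (not necessarily injective or surjective) distance-preserving map; a map $f:X\to Y$ is *Lipschitz* if $d_Y(f(x),f(y))\le L\,d_X(x,y)$ for some real $L\ge 0$ and all $x,y\in X$, and $\mathrm{Lip}(f)$ is the infimum of such $L$; it is *non-expanding* if $L=1$ is possible. A distance space $X$ is *injective* if for every isometry $i:X\to Y$ to a distance space there is a non-expanding $f:Y\to X$ with $f\circ i=\mathrm{id}_X$. For $A\subseteq X$ let $\underline d_X(A)=\inf(\{\infty\}\cup\{d_X(x,y):x,y\in A,\ x\neq y\})$. Let $d_{HX}$ be the Hausdorff distance on subsets of $X$ (with $d_{HX}(\emptyset,\emptyset)=0$ and $d_{HX}(\emptyset,A)=d_{HX}(A,\emptyset)=\infty$ for $A\neq\emptyset$). The $\{0,\infty\}$-valued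 $\infty$-metric takes the value $\infty$ at all pairs of distinct points. Let $F:\mathbf{Set}\to\mathbf{Set}$ be a covariant functor and $n=\{0,\dots,n-1\}$. For $A\subseteq X$ let $F[A;X]\subseteq FX$ be the image of $FA$ under the map induced by the inclusion. Assume that $F$ has *finite supports*: every $a\in FX$ lies in $F[A;X]$ for some finite $A\subseteq X$. Put $\mathrm{supp}(a)=\bigcap\{A\subseteq X:a\in F[A;X]\}$. The *degree* $\deg(F)$ is the smallest $n\le\omega$ with $|\mathrm{supp}(a)|\le n$ for all $X$ and all $a\in FX$; $F$ *preserves supports* if $\mathrm{supp}(Ff(a))=f[\mathrm{supp}(a)]$ for all $f:X\to Y$ and $a\in FX$. For $a\in F1$ let $\xi^a_X:X\to FX$ send $x$ to $F(0\mapsto x)(a)$. Let $p\in[1,\infty]$. For a distance space $X$ and $a,b\in FX$ let $d^p_{FX}(a,b)$ be the infimum (in $[0,\infty]$, $\inf\emptyset=\infty$) of $\sum_{i=0}^{l}d^p_{X^{n_i}}(f_i,g_i)$ over all finite sequences of triples $(a_i,f_i,g_i)\in Fn_i\times X^{n_i}\times X^{n_i}$, $0\le i\le l$, such that $a=Ff_0(a_0)$,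 $Fg_i(a_i)=Ff_{i+1}(a_{i+1})$ for $i<l$, and $b=Fg_l(a_l)$; here $d^p_{X^n}$ is the $\ell^p$-distance on $X^n$. Let $EX$ be the set of all minimal elements (for the pointwise order) of $\{f:X\to[0,\infty]\;:\;f(x)+f(y)\ge d_X(x,y)\ \text{for all } x,y\in X\}$, with the sup-distance induced by the distance on $[0,\infty]$ which is $|s-t|$ for finite $s,t$, and $0$ if $s=t=\infty$, and $\infty$ if exactly one of $s,t$ is infinite. Let $\mathsf e_X:X\to EX$, $\mathsf e_X(z)=d_X(\cdot,z)$, and define $$\check d^p_{FX}(a,b)=d^p_{FEX}\big(F\mathsf e_X(a),F\mathsf e_X(b)\big)\qquad(a,b\in FX).$$ Let $\check F^p$ send a distance space $X$ to $(FX,\check d^p_{FX})$ and a function $f:X\to Y$ to $\check F^pf=Ff$. **Theorem.** Let $n=\max\{1,\deg(F)\}$. For every nonempty distance space $(X,d_X)$: 1. $\check d^p_{FX}(a,b)=\infty$ for distinct $a,b\in FX$ with $|\mathrm{supp}(a)\cup\mathrm{supp}(b)|\le1$. 2. $\check d^\infty_{FX}\le\check d^p_{FX}\le\check d^1_{FX}$,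 and if $\deg(F)<\omega$, then $\check d^p_{FX}\le n^{1/p}\cdot\check d^\infty_{FX}$. 3. $\check d^p_{FX}\le d^p_{FX}$; if $\deg(F)<\omega$, then $d^\infty_{FX}\le n\cdot|Fn|\cdot\check d^\infty_{FX}$ (where $|Fn|$ is read as $\infty$ if $Fn$ is infinite; $n\cdot|Fn|$ is finite if $F$ maps finite sets to finite sets); and $\check d^p_{FX}=d^p_{FX}$ if $(X,d_X)$ is injective. 4. For every Lipschitz map $f$ between distance spaces the map $\check F^pf$ is Lipschitz and $\mathrm{Lip}(\check F^pf)\le\mathrm{Lip}(f)$. 5. For every isometry $f$ between distance spaces the map $\check F^pf$ is an isometry. 6. $\check d^p_{FX}$ is a pseudometric if $d_X$ is a pseudometric and $F1$ is a singleton. 7. $\check d^1_{FX}(a,b)\ge\underline d_X(\mathrm{supp}(a)\cup\mathrm{supp}(b))$ for any distinct $a,b\in FX$. 8. If $F$ preserves supports, then for any distinct $a,b\in FX$, $\check d^p_{FX}(a,b)\ge\check d^\infty_{FX}(a,b)\ge\max\{d_{HX}(\mathrm{supp}(a),\mathrm{supp}(b)),\tfrac13\underline d_X(\mathrm{supp}(a)\cup\mathrm{supp}(b))\}$.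 9. $\check d^p_{FX}$ is an $\infty$-metric if $d_X$ and $d^p_{FEX}$ are $\infty$-metrics. 10. $\check d^p_{FX}$ is an $\infty$-metric if $d_X$ is an $\infty$-metric and (i) $p=1$, or (ii) $\deg(F)<\omega$, or (iii) $F$ preserves supports. 11. $\check d^p_{FX}$ is a metric if $d_X$ is a metric, $F1$ is a singleton, and one of (i), (ii), (iii) of item 10 holds. 12. If for some $a\in F1$ the map $\xi^a_2:2\to F2$ is injective, and $p=1$ or $F$ preserves supports, then $\xi^a_X:X\to(FX,\check d^p_{FX})$ is an injective isometry. 13. If $d_X$ is the $\{0,\infty\}$-valued $\infty$-metric on $X$, then $\check d^p_{FX}$ is the $\{0,\infty\}$-valued $\infty$-metric on $FX$. -/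

import Mathlib

open CategoryTheory
open scoped ENNReal NNReal

universe u

noncomputable section

namespace SetFunctor

/-! ### Functors `Set → Set`, supports, degree

Distance spaces (symmetric `[0,∞]`-valued functions vanishing on the diagonal and satisfying the
triangle inequality) are Mathlib's `PseudoEMetricSpace`s. -/

/-- The finite ordinal `n = {0, …, n-1}` as a set of the universe under consideration. -/
abbrev FinOrd (n : ℕ) : Type u := ULift.{u} (Fin n)

/-- The function `Ff : FX → FY` induced by a function `f : X → Y`. -/
def fmap (F : Type u ⥤ Type u) {X Y : Type u} (f : X → Y) (a : F.obj X) : F.obj Y :=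
  F.map (TypeCat.ofHom f) a

theorem fmap_id (F : Type u ⥤ Type u) {X : Type u} (a : F.obj X) :
    fmap F (fun x : X => x) a = a := by
  have h : (TypeCat.ofHom (fun x : X => x)) = 𝟙 X := rfl
  simp [fmap, h]

theorem fmap_comp (F : Type u ⥤ Type u) {X Y Z : Type u} (g : Y → Z) (f : X → Y) (a : F.obj X) :
    fmap F (fun x => g (f x)) a = fmap F g (fmap F f a) := by
  have h : (TypeCat.ofHom (fun x => g (f x))) = TypeCat.ofHom f ≫ TypeCat.ofHom g := rfl
  simp [fmap, h]

/-- `F[A;X]`, the image of `FA` in `FX` under the map induced by the inclusion `A ⊆ X`. -/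
def imageOf (F : Type u ⥤ Type u) {X : Type u} (A : Set X) : Set (F.obj X) :=
  Set.range (fmap F (fun x : A => (x : X)))

/-- Functors with finite supports. -/
class HasFiniteSupports (F : Type u ⥤ Type u) : Prop where
  exists_finite : ∀ (X : Type u) (a : F.obj X), ∃ A : Set X, A.Finite ∧ a ∈ imageOf F A

/-- The support of an element `a ∈ FX`. -/
def supp (F : Type u ⥤ Type u) {X : Type u} (a : F.obj X) : Set X :=
  ⋂₀ {A : Set X | a ∈ imageOf F A}

/-- `F` preserves supports. -/
def PreservesSupports (F : Type u ⥤ Type u) : Prop :=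
  ∀ (X Y : Type u) (f : X → Y) (a : F.obj X), supp F (fmap F f a) = f '' supp F a

/-- `F` has degree at most `n`. -/
def HasDegreeLE (F : Type u ⥤ Type u) (n : ℕ∞) : Prop :=
  ∀ (X : Type u) (a : F.obj X), (supp F a).encard ≤ n

/-- The degree of `F` (`⊤` stands for `ω`). -/
def deg (F : Type u ⥤ Type u) : ℕ∞ := sInf {n : ℕ∞ | HasDegreeLE F n}

/-- `F` has finite degree. -/
def HasFiniteDegree (F : Type u ⥤ Type u) : Prop := deg F < ⊤

/-- The number `max {1, deg F}`; it is used only for functors of finite degree. -/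
def degOne (F : Type u ⥤ Type u) : ℕ := max 1 (deg F).toNat

/-- `F1` is a singleton. -/
def PreservesSingletons (F : Type u ⥤ Type u) : Prop := Nonempty (Unique (F.obj (FinOrd.{u} 1)))

/-- For `a ∈ F1`, the map `ξ^a_X : X → FX`. -/
def xi (F : Type u ⥤ Type u) (a : F.obj (FinOrd.{u} 1)) (X : Type u) (x : X) : F.obj X :=
  fmap F (fun _ => x) a

/-! ### The distance `d^p_{FX}` -/

/-- Triples `(a, f, g)` in `⋃ₙ Fn × Xⁿ × Xⁿ`. -/
structure Link (F : Type u ⥤ Type u) (X : Type u) where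
  n : ℕ
  elt : F.obj (FinOrd.{u} n)
  f : FinOrd.{u} n → X
  g : FinOrd.{u} n → X

namespace Link

variable {F : Type u ⥤ Type u} {X : Type u}

/-- `Ff(a)`. -/
def src (s : Link F X) : F.obj X := fmap F s.f s.elt

/-- `Fg(a)`. -/
def tgt (s : Link F X) : F.obj X := fmap F s.g s.elt

/-- The `ℓ^p`-distance between `f` and `g` in `Xⁿ`. -/
def cost [PseudoEMetricSpace X] (p : ℝ≥0∞) (s : Link F X) : ℝ≥0∞ :=
  edist (WithLp.toLp p s.f : PiLp p (fun _ : FinOrd.{u} s.n => X)) (WithLp.toLp p s.g)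

/-- Interchanging `f` and `g`. -/
def swap (s : Link F X) : Link F X := ⟨s.n, s.elt, s.g, s.f⟩

end Link

/-- `L` is an `(a,b)`-linking chain: a non-empty finite sequence of triples, in which every triple
ends where its successor starts, and which leads from `a` to `b`. -/
structure IsLinkingChain (F : Type u ⥤ Type u) {X : Type u} (a b : F.obj X)
    (L : List (Link F X)) : Prop where
  linked : L.IsChain (fun s t => s.tgt = t.src)
  head : L.head?.map Link.src = some a
  last : L.getLast?.map Link.tgt = some b

/-- The distance `d^p_{FX}(a,b)`: the infimum (`∞` if there are none) over all `(a,b)`-linking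
chains of the total `ℓ^p`-length of the chain. -/
def lpDist (F : Type u ⥤ Type u) (p : ℝ≥0∞) {X : Type u} [PseudoEMetricSpace X]
    (a b : F.obj X) : ℝ≥0∞ :=
  ⨅ (L : List (Link F X)) (_ : IsLinkingChain F a b L), (L.map (Link.cost p)).sum

section LpDist

variable {F : Type u ⥤ Type u} {X : Type u}

theorem IsLinkingChain.append {a b c : F.obj X} {L M : List (Link F X)}
    (hL : IsLinkingChain F a b L) (hM : IsLinkingChain F b c M) :
    IsLinkingChain F a c (L ++ M) := by
  obtain ⟨h1, h2, h3⟩ := hL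
  obtain ⟨k1, k2, k3⟩ := hM
  refine ⟨List.isChain_append.2 ⟨h1, k1, ?_⟩, ?_, ?_⟩
  · intro x hx y hy
    rw [Option.mem_def] at hx hy
    rw [hx, Option.map_some, Option.some_inj] at h3
    rw [hy, Option.map_some, Option.some_inj] at k2
    rw [h3, k2]
  · cases hL : L.head? with
    | none => simp [hL] at h2
    | some x => simpa [List.head?_append, hL] using h2
  · cases hM : M.getLast? with
    | none => simp [hM] at k3
    | some x => simpa [List.getLast?_append, hM] using k3

theorem IsLinkingChain.reverse {a b : F.obj X} {L : List (Link F X)}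
    (hL : IsLinkingChain F a b L) :
    IsLinkingChain F b a (L.map Link.swap).reverse := by
  obtain ⟨h1, h2, h3⟩ := hL
  refine ⟨?_, ?_, ?_⟩
  · rw [List.isChain_reverse, List.isChain_map]
    exact h1.imp (fun s t h => h.symm)
  · rw [List.head?_reverse, List.getLast?_map, Option.map_map]
    exact h3
  · rw [List.getLast?_reverse, List.head?_map, Option.map_map]
    exact h2

theorem exists_ord_map [HasFiniteSupports F] (a : F.obj X) :
    ∃ (n : ℕ) (f : FinOrd.{u} n → X) (c : F.obj (FinOrd.{u} n)), fmap F f c = a := by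
  obtain ⟨A, hA, c, hc⟩ := HasFiniteSupports.exists_finite X a
  have := hA.fintype
  let e : A ≃ FinOrd.{u} (Fintype.card A) := (Fintype.equivFin A).trans Equiv.ulift.symm
  refine ⟨_, fun i => (e.symm i : X), fmap F e c, ?_⟩
  rw [← fmap_comp]
  simpa using hc

theorem lpDist_self [HasFiniteSupports F] [PseudoEMetricSpace X] (p : ℝ≥0∞) [Fact (1 ≤ p)]
    (a : F.obj X) : lpDist F p a a = 0 := by
  obtain ⟨n, f, c, rfl⟩ := exists_ord_map a
  refine le_antisymm (iInf₂_le_of_le [⟨n, c, f, f⟩] ⟨by simp, rfl, rfl⟩ ?_) zero_le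
  simp [Link.cost]

theorem lpDist_comm_le [PseudoEMetricSpace X] (p : ℝ≥0∞) [Fact (1 ≤ p)] (a b : F.obj X) :
    lpDist F p b a ≤ lpDist F p a b := by
  refine le_iInf₂ fun L hL => iInf₂_le_of_le _ hL.reverse ?_
  rw [List.map_reverse, List.sum_reverse, List.map_map]
  refine le_of_eq (congrArg List.sum (List.map_congr_left fun s _ => ?_))
  exact edist_comm _ _

theorem lpDist_triangle [PseudoEMetricSpace X] (p : ℝ≥0∞) (a b c : F.obj X) :
    lpDist F p a c ≤ lpDist F p a b + lpDist F p b c := by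
  rw [lpDist, lpDist, lpDist]
  simp only [iInf_subtype']
  refine ENNReal.le_iInf_add_iInf fun ⟨L, hL⟩ ⟨M, hM⟩ => ?_
  refine iInf_le_of_le ⟨L ++ M, hL.append hM⟩ ?_
  simp

end LpDist

/-- The `ℓ^p`-metrization `F^p X = (FX, d^p_{FX})` on objects. -/
def LpSpace (F : Type u ⥤ Type u) (_p : ℝ≥0∞) (X : Type u) : Type u := F.obj X

instance (F : Type u ⥤ Type u) [HasFiniteSupports F] (p : ℝ≥0∞) [Fact (1 ≤ p)] (X : Type u)
    [PseudoEMetricSpace X] : PseudoEMetricSpace (LpSpace F p X) where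
  edist a b := lpDist F p (X := X) a b
  edist_self := lpDist_self p
  edist_comm a b := le_antisymm (lpDist_comm_le p _ _) (lpDist_comm_le p _ _)
  edist_triangle := lpDist_triangle p

/-! ### The injective envelope -/

/-- The distance on `[0,∞]`: `|x - y|` for finite `x`, `y`, and `0` or `∞` according to whether
`x = y` or not otherwise (truncated subtraction, with `∞ - ∞ = 0`). -/
def halfLineDist (x y : ℝ≥0∞) : ℝ≥0∞ := max (x - y) (y - x)

theorem halfLineDist_triangle (x y z : ℝ≥0∞) :
    halfLineDist x z ≤ halfLineDist x y + halfLineDist y z := by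
  refine max_le ?_ ?_
  · exact tsub_le_tsub_add_tsub.trans (add_le_add (le_max_left _ _) (le_max_left _ _))
  · rw [add_comm]
    exact tsub_le_tsub_add_tsub.trans (add_le_add (le_max_right _ _) (le_max_right _ _))

/-- Membership in `ΔX`. Functions satisfying this inequality are automatically non-negative
(take `x = y`), so that one may take `[0,∞]` as the codomain from the start. -/
def InDelta (X : Type u) [PseudoEMetricSpace X] (f : X → ℝ≥0∞) : Prop :=
  ∀ x y, edist x y ≤ f x + f y

/-- The injective envelope `EX`: the set of minimal elements of `ΔX`. -/
def Envelope (X : Type u) [PseudoEMetricSpace X] : Type u :=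
  {f : X → ℝ≥0∞ // Minimal (InDelta X) f}

/-- The sup-distance of `EX`. -/
instance (X : Type u) [PseudoEMetricSpace X] : PseudoEMetricSpace (Envelope X) where
  edist f g := ⨆ x, halfLineDist (f.1 x) (g.1 x)
  edist_self f := by simp [halfLineDist]
  edist_comm f g := by simp [halfLineDist, max_comm]
  edist_triangle f g h := iSup_le fun x =>
    (halfLineDist_triangle _ _ _).trans (add_le_add
      (le_iSup (fun x => halfLineDist (f.1 x) (g.1 x)) x)
      (le_iSup (fun x => halfLineDist (g.1 x) (h.1 x)) x))

theorem minimal_edist (X : Type u) [PseudoEMetricSpace X] (z : X) :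
    Minimal (InDelta X) (fun x => edist x z) := by
  refine ⟨fun x y => edist_triangle_right x y z, fun f hf hle x => ?_⟩
  have hz : f z = 0 := le_antisymm (by simpa using hle z) zero_le
  simpa [hz] using hf x z

/-- The canonical map `e_X : X → EX`, `z ↦ d_X(·, z)`. -/
def toEnvelope (X : Type u) [PseudoEMetricSpace X] (z : X) : Envelope X :=
  ⟨fun x => edist x z, minimal_edist X z⟩

/-! ### The modified distance -/

/-- The modified distance on `FX`:
the distance `d^p_{FEX}` between the images under `F e_X`. -/
def checkDist (F : Type u ⥤ Type u) (p : ℝ≥0∞) {X : Type u} [PseudoEMetricSpace X]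
    (a b : F.obj X) : ℝ≥0∞ :=
  lpDist F p (fmap F (toEnvelope X) a) (fmap F (toEnvelope X) b)

/-- The modified metrization of `F` on objects: `FX` with the modified distance. -/
def CheckLp (F : Type u ⥤ Type u) (_p : ℝ≥0∞) (X : Type u) : Type u := F.obj X

instance (F : Type u ⥤ Type u) [HasFiniteSupports F] (p : ℝ≥0∞) [Fact (1 ≤ p)] (X : Type u)
    [PseudoEMetricSpace X] : PseudoEMetricSpace (CheckLp F p X) where
  edist a b := checkDist F p (X := X) a b
  edist_self _ := lpDist_self p _
  edist_comm a b := le_antisymm (lpDist_comm_le p _ _) (lpDist_comm_le p _ _)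
  edist_triangle _ _ _ := lpDist_triangle p _ _ _

/-- The modified metrization of `F` on morphisms: a function `f` is sent to `Ff`. -/
def CheckLp.map (F : Type u ⥤ Type u) (p : ℝ≥0∞) {X Y : Type u} (f : X → Y) :
    CheckLp F p X → CheckLp F p Y :=
  fmap F f

/-! ### Properties of distance spaces and of maps between them -/

/-- The distance is an `∞`-metric. -/
def IsInftyMetric (X : Type u) [PseudoEMetricSpace X] : Prop :=
  ∀ x y : X, x ≠ y → 0 < edist x y

/-- The distance is a pseudometric. -/
def IsPseudometric (X : Type u) [PseudoEMetricSpace X] : Prop :=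
  ∀ x y : X, edist x y < ⊤

/-- The distance is a metric. -/
def IsMetric (X : Type u) [PseudoEMetricSpace X] : Prop :=
  IsPseudometric X ∧ IsInftyMetric X

/-- The distance is the `{0,∞}`-valued `∞`-metric. -/
def IsZeroInftyMetric (X : Type u) [PseudoEMetricSpace X] : Prop :=
  ∀ x y : X, x ≠ y → edist x y = ⊤

/-- Injective distance spaces. -/
def IsInjectiveSpace (X : Type u) [PseudoEMetricSpace X] : Prop :=
  ∀ (Y : Type u) [PseudoEMetricSpace Y] (i : X → Y), Isometry i →
    ∃ f : Y → X, LipschitzWith 1 f ∧ ∀ x, f (i x) = x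

/-- The map `f` is Lipschitz. -/
def IsLipschitz {X Y : Type u} [PseudoEMetricSpace X] [PseudoEMetricSpace Y] (f : X → Y) : Prop :=
  ∃ K : ℝ≥0, LipschitzWith K f

/-- The Lipschitz constant of a Lipschitz map. -/
def lipConst {X Y : Type u} [PseudoEMetricSpace X] [PseudoEMetricSpace Y] (f : X → Y) : ℝ≥0 :=
  sInf {K : ℝ≥0 | LipschitzWith K f}

end SetFunctor

end

open SetFunctor

/-! The modified distance `checkDist` is the distance `lpDist` of the injective envelope, pulled back
along `F e_X`. Its behaviour under maps follows from two facts: `lpDist` is functorial for Lipschitz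
maps (`lpDist_fmap_le`), and the envelope is injective in the strong sense that partial Lipschitz maps
into it extend with the same constant (`exists_lipschitzWith_envelope`). The latter rests on a
non-expanding retraction of `ΔX` onto its minimal elements, obtained from Zorn's lemma applied to maps
instead of functions (`exists_isShrinking_minimal`).

The bounds by separation come from one principle: if a map `h` identifies source and target of
every link of a chain, then `Fh` identifies the ends of the chain (`IsLinkingChain.map_eq`). For the exponent `1`,
join `f_i(k)` to `g_i(k)` for all links and all `k`. The components of this graph have diameters at
most the `ℓ^1`-length of the chain, because simple paths use each edge at most once, and `h` sends
each component to one of its points in `X` (`IsLinkingChain.exists_collapse`). If the chain is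
shorter than the separation of the supports of its ends, then `h` fixes these supports and the ends
coincide. Without this assumption `h` moves points at most by the `ℓ^1`-length, which bounds the
distance in `FX` by `2` times the modified `ℓ^1`-distance (`lpDist_top_le_two_mul`); the factor
`|Fn|` of the theorem absorbs the `2` unless `|Fn| ≤ 1`, where `FX` is described completely by
a canonical map `ξ` (`lpDist_top_le_mul_checkDist`).

If `F` preserves supports, then the supports along a chain move in the Hausdorff distance at most by
the `ℓ^∞`-length, and one uses the nearest point map onto the supports of the ends instead
(`PreservesSupports.einfsep_div_three_le_lpDist`). In finite degree `n`, links over `max {1, n}`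
points suffice, which relates the exponents (`lpDist_le_mul_lpDist_top`). Finally, the finiteness of
the `ℓ^p`-length of a chain does not depend on `p` (`lpDist_top_eq_top`), so that infinite lower
bounds for `p = 1` carry over to all `p`. -/

namespace SetFunctor

/-! ### Elements over subsets and supports -/

section Supports

variable {F : Type u ⥤ Type u} {X Y : Type u}

theorem fmap_congr_of_mem {A : Set X} {a : F.obj X} (ha : a ∈ imageOf F A) {f g : X → Y}
    (h : ∀ x ∈ A, f x = g x) : fmap F f a = fmap F g a := by
  obtain ⟨c, rfl⟩ := ha
  rw [← fmap_comp, ← fmap_comp]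
  congr 1
  funext x
  exact h x x.2

theorem fmap_eq_self_of_mem {A : Set X} {a : F.obj X} (ha : a ∈ imageOf F A) {f : X → X}
    (h : ∀ x ∈ A, f x = x) : fmap F f a = a :=
  (fmap_congr_of_mem ha h).trans (fmap_id F a)

theorem fmap_leftInverse {f : X → Y} {g : Y → X} (h : ∀ x, g (f x) = x) (a : F.obj X) :
    fmap F g (fmap F f a) = a := by
  rw [← fmap_comp, funext h]
  exact fmap_id F a

theorem fmap_injective [Nonempty X] {f : X → Y} (hf : Function.Injective f) :
    Function.Injective (fmap F f) :=
  Function.LeftInverse.injective (fmap_leftInverse (Function.leftInverse_invFun hf))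

theorem mem_imageOf_of_forall_mem {A : Set Y} {f : X → Y} (h : ∀ x, f x ∈ A) (a : F.obj X) :
    fmap F f a ∈ imageOf F A :=
  ⟨fmap F (fun x => (⟨f x, h x⟩ : A)) a, (fmap_comp F _ _ a).symm⟩

theorem mem_imageOf_univ (a : F.obj X) : a ∈ imageOf F Set.univ := by
  simpa only [fmap_id] using
    mem_imageOf_of_forall_mem (f := fun x : X => x) (fun x => Set.mem_univ x) a

theorem imageOf_mono {A B : Set X} (h : A ⊆ B) : imageOf F A ⊆ imageOf F B := by
  rintro _ ⟨c, rfl⟩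
  exact mem_imageOf_of_forall_mem (fun x : A => h x.2) c

theorem supp_subset_of_mem {A : Set X} {a : F.obj X} (h : a ∈ imageOf F A) : supp F a ⊆ A :=
  Set.sInter_subset_of_mem h

/-- If `A ∩ B` has a point `z`, then `a` is fixed by the retractions of `X` onto `A` and onto `B`
that send the complements to `z`, and the composition of these takes values in `A ∩ B`. -/
theorem mem_imageOf_inter {A B : Set X} {a : F.obj X} (hA : a ∈ imageOf F A)
    (hB : a ∈ imageOf F B) (hAB : (A ∩ B).Nonempty) : a ∈ imageOf F (A ∩ B) := by
  classical
  obtain ⟨z, hzA, hzB⟩ := hAB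
  let r : X → X := fun x => if x ∈ A then x else z
  let s : X → X := fun x => if x ∈ B then x else z
  have h : fmap F (fun x => s (r x)) a = a := by
    rw [fmap_comp, fmap_eq_self_of_mem (f := r) hA fun x hx => by simp [r, hx],
      fmap_eq_self_of_mem (f := s) hB fun x hx => by simp [s, hx]]
  rw [← h]
  refine mem_imageOf_of_forall_mem (fun x => ?_) a
  by_cases hx : x ∈ A <;> by_cases hx' : x ∈ B <;> simp [r, s, hx, hx', hzA, hzB]

theorem encard_supp_le_deg (a : F.obj X) : (supp F a).encard ≤ deg F :=
  le_csInf ⟨⊤, fun _ _ => le_top⟩ fun _ hn => hn X a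

variable [HasFiniteSupports F]

/-- An extra point is needed only where the support is empty: then `a` comes from every
one-point subset, but possibly not from the empty set. -/
theorem mem_imageOf_insert_supp (a : F.obj X) (x : X) :
    a ∈ imageOf F (insert x (supp F a)) := by
  obtain ⟨A₀, hA₀, ha₀⟩ := HasFiniteSupports.exists_finite X a
  -- a finite set of minimal cardinality among those which contain `x` and support `a`
  let P : Set (Set X) := {A | A.Finite ∧ x ∈ A ∧ a ∈ imageOf F A}
  have hP : P.Nonempty :=
    ⟨insert x A₀, hA₀.insert x, Set.mem_insert _ _, imageOf_mono (Set.subset_insert _ _) ha₀⟩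
  obtain ⟨A, ⟨hAf, hxA, haA⟩, hmin⟩ := exists_minimalFor_of_wellFoundedLT (· ∈ P) Set.ncard hP
  refine imageOf_mono (fun y hy => ?_) haA
  by_contra hcon
  rw [Set.mem_insert_iff, not_or, supp, Set.mem_sInter] at hcon
  obtain ⟨hyx, hcon⟩ := hcon
  push Not at hcon
  obtain ⟨B, hB, hyB⟩ := hcon
  have hmem : A ∩ insert x B ∈ P := ⟨hAf.inter_of_left _, ⟨hxA, Set.mem_insert _ _⟩,
    mem_imageOf_inter haA (imageOf_mono (Set.subset_insert _ _) hB)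
      ⟨x, hxA, Set.mem_insert _ _⟩⟩
  have hlt : (A ∩ insert x B).ncard < A.ncard :=
    Set.ncard_lt_ncard ⟨Set.inter_subset_left, fun h => by
      have := (h hy).2
      simp [hyx, hyB] at this⟩ hAf
  exact absurd (hmin hmem hlt.le) (not_le.2 hlt)

theorem mem_imageOf_of_supp_subset {a : F.obj X} {A : Set X} (hA : A.Nonempty)
    (h : supp F a ⊆ A) : a ∈ imageOf F A := by
  obtain ⟨x, hx⟩ := hA
  exact imageOf_mono (Set.insert_subset hx h) (mem_imageOf_insert_supp a x)

theorem finite_supp (a : F.obj X) : (supp F a).Finite := by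
  obtain ⟨A, hA, ha⟩ := HasFiniteSupports.exists_finite X a
  exact hA.subset (supp_subset_of_mem ha)

/-- If `F` preserves supports, then the exceptional behaviour of empty supports disappears. -/
theorem PreservesSupports.mem_imageOf_supp (hF : PreservesSupports F) (a : F.obj X) :
    a ∈ imageOf F (supp F a) := by
  rcases (supp F a).eq_empty_or_nonempty with h | h
  · by_cases hX : Nonempty X
    · obtain ⟨x⟩ := hX
      obtain ⟨c, hc⟩ := mem_imageOf_of_supp_subset (Set.singleton_nonempty x)
        (h.symm ▸ Set.empty_subset {x})
      have hc0 : supp F c = ∅ := by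
        rw [← hc, hF] at h
        exact Set.image_eq_empty.1 h
      have : ∃ A : Set ({x} : Set X), c ∈ imageOf F A ∧ (⟨x, rfl⟩ : ({x} : Set X)) ∉ A := by
        have hx : (⟨x, rfl⟩ : ({x} : Set X)) ∉ supp F c := hc0 ▸ Set.notMem_empty _
        simpa [supp] using hx
      obtain ⟨A, hA, hxA⟩ := this
      have hA0 : A = ∅ := by
        refine Set.eq_empty_of_forall_notMem fun y hy => hxA ?_
        rwa [Subsingleton.elim y ⟨x, rfl⟩] at hy
      subst hA0
      obtain ⟨d, rfl⟩ := hA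
      rw [← hc, ← fmap_comp]
      exact mem_imageOf_of_forall_mem (fun y => y.2.elim) d
    · have : supp F a = Set.univ := by
        rw [h]
        exact (Set.eq_empty_of_forall_notMem fun x _ => hX ⟨x⟩).symm
      rw [this]
      exact mem_imageOf_univ a
  · exact mem_imageOf_of_supp_subset h le_rfl

/-- Two elements of `FX` come from a common set with the same separation as the union of their
supports; it is this union unless the supports are empty. -/
theorem exists_mem_imageOf_einfsep [PseudoEMetricSpace X] [Nonempty X] (a b : F.obj X) :
    ∃ S : Set X, a ∈ imageOf F S ∧ b ∈ imageOf F S ∧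
      S.einfsep = (supp F a ∪ supp F b).einfsep := by
  rcases (supp F a ∪ supp F b).eq_empty_or_nonempty with h | h
  · obtain ⟨x⟩ := ‹Nonempty X›
    have h' := Set.union_empty_iff.1 h
    refine ⟨{x}, mem_imageOf_of_supp_subset ⟨x, rfl⟩ (by simp [h'.1]),
      mem_imageOf_of_supp_subset ⟨x, rfl⟩ (by simp [h'.2]), ?_⟩
    simp [h]
  · exact ⟨_, mem_imageOf_of_supp_subset h Set.subset_union_left,
      mem_imageOf_of_supp_subset h Set.subset_union_right, rfl⟩

/-- For a functor of finite degree every element over a nonempty set comes from `Fn` where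
`n = max {1, deg F}`. -/
theorem exists_degOne_map (hF : HasFiniteDegree F) [Nonempty X] (a : F.obj X) :
    ∃ (f : FinOrd.{u} (degOne F) → X) (c : F.obj (FinOrd.{u} (degOne F))), fmap F f c = a := by
  obtain ⟨A, hA, haA, hcard⟩ : ∃ A : Set X, A.Nonempty ∧ a ∈ imageOf F A ∧
      A.encard ≤ degOne F := by
    rcases (supp F a).eq_empty_or_nonempty with h | h
    · obtain ⟨x⟩ := ‹Nonempty X›
      refine ⟨{x}, ⟨x, rfl⟩, mem_imageOf_of_supp_subset ⟨x, rfl⟩ (by simp [h]), ?_⟩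
      simp [degOne]
    · refine ⟨_, h, mem_imageOf_of_supp_subset h le_rfl, (encard_supp_le_deg a).trans ?_⟩
      rw [← ENat.natCast_toNat hF.ne]
      exact_mod_cast le_max_right _ _
  have hfin : A.Finite := Set.finite_of_encard_le_coe hcard
  have := hfin.fintype
  have := hA.to_subtype
  obtain ⟨e⟩ : Nonempty (A ↪ FinOrd.{u} (degOne F)) := by
    refine Function.Embedding.nonempty_of_card_le ?_
    rw [Set.encard_eq_coe_toFinset_card, Nat.cast_le, Set.toFinset_card] at hcard
    simpa using hcard
  obtain ⟨c, rfl⟩ := haA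
  refine ⟨fun i => (Function.invFun e i : A), fmap F e c, ?_⟩
  rw [← fmap_comp]
  congr 1
  funext x
  rw [Function.leftInverse_invFun e.injective]

end Supports

/-! ### Costs of links and comparison of lengths of chains -/

section Costs

variable {F : Type u ⥤ Type u} {X Y : Type u} [PseudoEMetricSpace X] [PseudoEMetricSpace Y]

theorem exponent_toReal_pos {p : ℝ≥0∞} [Fact (1 ≤ p)] (hp : p ≠ ⊤) : 0 < p.toReal :=
  ENNReal.toReal_pos (one_pos.trans_le Fact.out).ne' hp

theorem one_le_exponent_toReal {p : ℝ≥0∞} [Fact (1 ≤ p)] (hp : p ≠ ⊤) : 1 ≤ p.toReal := by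
  simpa using ENNReal.toReal_mono hp (Fact.out : 1 ≤ p)

namespace Link

/-- The image of a link under a map `h : X → Y`. -/
def map (h : X → Y) (s : Link F X) : Link F Y :=
  ⟨s.n, s.elt, fun i => h (s.f i), fun i => h (s.g i)⟩

theorem cost_eq_sum {p : ℝ≥0∞} [Fact (1 ≤ p)] (hp : p ≠ ⊤) (s : Link F X) :
    s.cost p = (∑ i, edist (s.f i) (s.g i) ^ p.toReal) ^ (1 / p.toReal) :=
  PiLp.edist_eq_sum (exponent_toReal_pos hp) _ _

theorem cost_one (s : Link F X) : s.cost 1 = ∑ i, edist (s.f i) (s.g i) := by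
  simp [cost_eq_sum ENNReal.one_ne_top]

theorem cost_map_le (p : ℝ≥0∞) [Fact (1 ≤ p)] {K : ℝ≥0} {h : X → Y} (hh : LipschitzWith K h)
    (s : Link F X) : (s.map h).cost p ≤ K * s.cost p := by
  by_cases hp : p = ⊤
  · subst hp
    refine iSup_le fun i => (hh _ _).trans ?_
    gcongr
    exact le_iSup (fun i => edist (s.f i) (s.g i)) i
  · rw [cost_eq_sum hp, cost_eq_sum hp]
    have h0 := exponent_toReal_pos hp
    rw [one_div, ENNReal.rpow_inv_le_iff h0, ENNReal.mul_rpow_of_nonneg _ _ h0.le,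
      ENNReal.rpow_inv_rpow h0.ne', Finset.mul_sum]
    refine Finset.sum_le_sum fun i _ => ?_
    rw [← ENNReal.mul_rpow_of_nonneg _ _ h0.le]
    exact ENNReal.rpow_le_rpow (hh _ _) h0.le

theorem cost_top_le_cost (p : ℝ≥0∞) [Fact (1 ≤ p)] (s : Link F X) : s.cost ⊤ ≤ s.cost p := by
  by_cases hp : p = ⊤
  · rw [hp]
  · have h0 := exponent_toReal_pos hp
    rw [cost_eq_sum hp, one_div]
    refine iSup_le fun i => (ENNReal.le_rpow_inv_iff h0).2 ?_
    exact Finset.single_le_sum (f := fun i => edist (s.f i) (s.g i) ^ p.toReal)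
      (fun _ _ => zero_le) (Finset.mem_univ i)

theorem cost_le_cost_one (p : ℝ≥0∞) [Fact (1 ≤ p)] (s : Link F X) : s.cost p ≤ s.cost 1 := by
  by_cases hp : p = ⊤
  · rw [hp]
    exact cost_top_le_cost 1 s
  · have h0 := exponent_toReal_pos hp
    rw [cost_eq_sum hp, one_div, ENNReal.rpow_inv_le_iff h0, cost_one]
    induction (Finset.univ : Finset (FinOrd.{u} s.n)) using Finset.cons_induction with
    | empty => simp
    | cons i t hi ih =>
      rw [Finset.sum_cons, Finset.sum_cons]
      exact (add_le_add le_rfl ih).trans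
        (ENNReal.add_rpow_le_rpow_add _ _ (one_le_exponent_toReal hp))

theorem cost_le_mul_cost_top (p : ℝ≥0∞) [Fact (1 ≤ p)] (s : Link F X) :
    s.cost p ≤ (s.n : ℝ≥0∞) ^ (1 / p).toReal * s.cost ⊤ := by
  by_cases hp : p = ⊤
  · simp [hp]
  · have h0 := exponent_toReal_pos hp
    rw [cost_eq_sum hp, one_div, ENNReal.rpow_inv_le_iff h0, ENNReal.mul_rpow_of_nonneg _ _ h0.le,
      one_div, ENNReal.toReal_inv, ENNReal.rpow_inv_rpow h0.ne']
    refine (Finset.sum_le_card_nsmul _ _ (s.cost ⊤ ^ p.toReal) fun i _ => ?_).trans ?_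
    · exact ENNReal.rpow_le_rpow (le_iSup (fun i => edist (s.f i) (s.g i)) i) h0.le
    · simp

end Link

end Costs

section Chains

variable {F : Type u ⥤ Type u} {X Y : Type u}

theorem IsLinkingChain.cons_cases {a b : F.obj X} {s : Link F X} {L : List (Link F X)}
    (h : IsLinkingChain F a b (s :: L)) :
    s.src = a ∧ ((L = [] ∧ s.tgt = b) ∨ IsLinkingChain F s.tgt b L) := by
  obtain ⟨h1, h2, h3⟩ := h
  refine ⟨by simpa using h2, ?_⟩
  cases L with
  | nil => exact Or.inl ⟨rfl, by simpa using h3⟩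
  | cons t L =>
    rw [List.isChain_cons_cons] at h1
    exact Or.inr ⟨h1.2, by simpa using h1.1.symm, by simpa using h3⟩

/-- A map that identifies source and target of every link of a chain identifies the ends of the
chain. -/
theorem IsLinkingChain.map_eq {α : Type*} (G : F.obj X → α) {a b : F.obj X} {L : List (Link F X)}
    (hL : IsLinkingChain F a b L) (h : ∀ s ∈ L, G s.src = G s.tgt) : G a = G b := by
  induction L generalizing a with
  | nil => simpa using hL.head
  | cons s L ih =>
    obtain ⟨rfl, hs⟩ := hL.cons_cases
    rw [h s List.mem_cons_self]
    rcases hs with ⟨_, rfl⟩ | hs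
    · rfl
    · exact ih hs fun t ht => h t (List.mem_cons_of_mem _ ht)

theorem IsLinkingChain.map (G : F.obj X → F.obj Y) (φ : Link F X → Link F Y)
    (hs : ∀ s, (φ s).src = G s.src) (ht : ∀ s, (φ s).tgt = G s.tgt) {a b : F.obj X}
    {L : List (Link F X)} (hL : IsLinkingChain F a b L) :
    IsLinkingChain F (G a) (G b) (L.map φ) := by
  obtain ⟨h1, h2, h3⟩ := hL
  refine ⟨?_, ?_, ?_⟩
  · rw [List.isChain_map]
    exact h1.imp fun s t h => by rw [ht, hs, h]
  · rw [List.head?_map, Option.map_map, ← Option.map_some, ← h2, Option.map_map]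
    congr 1
    funext s
    exact hs s
  · rw [List.getLast?_map, Option.map_map, ← Option.map_some, ← h3, Option.map_map]
    congr 1
    funext s
    exact ht s

variable [PseudoEMetricSpace X] [PseudoEMetricSpace Y]

theorem lpDist_le_of_cost_le {p q K : ℝ≥0∞} (hK0 : K ≠ 0) (hK : K ≠ ⊤) (G : F.obj X → F.obj Y)
    (h : ∀ s : Link F X, ∃ t : Link F Y, t.src = G s.src ∧ t.tgt = G s.tgt ∧
      t.cost q ≤ K * s.cost p) (a b : F.obj X) :
    lpDist F q (G a) (G b) ≤ K * lpDist F p a b := by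
  choose φ hsrc htgt hcost using h
  rw [lpDist, lpDist]
  simp only [iInf_subtype']
  rw [ENNReal.mul_iInf_of_ne hK0 hK]
  refine le_iInf fun ⟨L, hL⟩ => iInf_le_of_le ⟨L.map φ, hL.map G φ hsrc htgt⟩ ?_
  rw [← List.sum_map_mul_left, List.map_map]
  exact List.sum_le_sum fun s _ => hcost s

theorem lpDist_fmap_le (p : ℝ≥0∞) [Fact (1 ≤ p)] {K : ℝ≥0} (hK : K ≠ 0) {h : X → Y}
    (hh : LipschitzWith K h) (a b : F.obj X) :
    lpDist F p (fmap F h a) (fmap F h b) ≤ K * lpDist F p a b :=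
  lpDist_le_of_cost_le (by simpa using hK) ENNReal.coe_ne_top _
    (fun s => ⟨s.map h, fmap_comp F h s.f s.elt, fmap_comp F h s.g s.elt, s.cost_map_le p hh⟩) a b

theorem lpDist_fmap_le_of_lipschitzWith_one (p : ℝ≥0∞) [Fact (1 ≤ p)] {h : X → Y}
    (hh : LipschitzWith 1 h) (a b : F.obj X) :
    lpDist F p (fmap F h a) (fmap F h b) ≤ lpDist F p a b := by
  simpa using lpDist_fmap_le p one_ne_zero hh a b

theorem lpDist_top_le (p : ℝ≥0∞) [Fact (1 ≤ p)] (a b : F.obj X) :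
    lpDist F ⊤ a b ≤ lpDist F p a b := by
  simpa using lpDist_le_of_cost_le (p := p) (q := ⊤) one_ne_zero ENNReal.one_ne_top id
    (fun s => ⟨s, rfl, rfl, by simpa using s.cost_top_le_cost p⟩) a b

theorem lpDist_le_one (p : ℝ≥0∞) [Fact (1 ≤ p)] (a b : F.obj X) :
    lpDist F p a b ≤ lpDist F 1 a b := by
  simpa using lpDist_le_of_cost_le (p := 1) (q := p) one_ne_zero ENNReal.one_ne_top id
    (fun s => ⟨s, rfl, rfl, by simpa using s.cost_le_cost_one p⟩) a b

/-- For each single chain the `ℓ^1`-length is finite if the `ℓ^∞`-length is, although without a bound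
on the degree there is no common bound for their ratio. -/
theorem lpDist_top_eq_top {a b : F.obj X} (h : lpDist F 1 a b = ⊤) : lpDist F ⊤ a b = ⊤ := by
  simp only [lpDist, iInf_eq_top] at h ⊢
  intro L hL
  by_contra hne
  refine absurd (h L hL) ?_
  clear hL h
  induction L with
  | nil => simp
  | cons s L ih =>
    simp only [List.map_cons, List.sum_cons, ENNReal.add_eq_top, not_or] at hne ⊢
    refine ⟨fun h1 => hne.1 ?_, ih hne.2⟩
    by_contra hs
    have := s.cost_le_mul_cost_top 1
    rw [h1, top_le_iff] at this
    exact ENNReal.mul_ne_top (by simp) hs this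

theorem lpDist_link_le (p : ℝ≥0∞) (s : Link F X) : lpDist F p s.src s.tgt ≤ s.cost p :=
  iInf₂_le_of_le [s] ⟨by simp, rfl, rfl⟩ (by simp)

variable [HasFiniteSupports F]

/-- In a functor of finite degree, links over at most `n = max {1, deg F}` points suffice, and on
`n` points the `ℓ^p`- and `ℓ^∞`-distances differ at most by the factor `n^{1/p}`. -/
theorem lpDist_le_mul_lpDist_top (hF : HasFiniteDegree F) (p : ℝ≥0∞) [Fact (1 ≤ p)]
    (a b : F.obj X) :
    lpDist F p a b ≤ (degOne F : ℝ≥0∞) ^ (1 / p).toReal * lpDist F ⊤ a b := by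
  have hn : (degOne F : ℝ≥0∞) ≠ 0 := by
    simp [degOne]
  refine lpDist_le_of_cost_le ?_ (ENNReal.rpow_ne_top_of_nonneg ENNReal.toReal_nonneg
    (ENNReal.natCast_ne_top _)) id (fun s => ?_) a b
  · simp [ENNReal.rpow_eq_zero_iff, hn]
  · obtain ⟨n, c, f, g⟩ := s
    rcases Nat.eq_zero_or_pos n with rfl | hpos
    · refine ⟨⟨0, c, f, g⟩, rfl, rfl, (Link.cost_le_cost_one p _).trans ?_⟩
      rw [Link.cost_one]
      have : IsEmpty (FinOrd.{u} 0) := ⟨fun i => i.down.elim0⟩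
      simp
    · have : Nonempty (FinOrd.{u} n) := ⟨⟨⟨0, hpos⟩⟩⟩
      obtain ⟨j, d, rfl⟩ := exists_degOne_map hF c
      refine ⟨⟨degOne F, d, fun i => f (j i), fun i => g (j i)⟩, fmap_comp F f j d,
        fmap_comp F g j d, (Link.cost_le_mul_cost_top p _).trans ?_⟩
      gcongr
      exact iSup_le fun i => le_iSup (fun i => edist (f i) (g i)) (j i)

end Chains

/-! ### The injective envelope -/

section Envelope

variable {X : Type u} [PseudoEMetricSpace X]

theorem halfLineDist_le_iff {s t c : ℝ≥0∞} : halfLineDist s t ≤ c ↔ s ≤ t + c ∧ t ≤ s + c := by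
  rw [halfLineDist, max_le_iff, tsub_le_iff_left, tsub_le_iff_left]

theorem edist_envelope_le_iff {f g : Envelope X} {c : ℝ≥0∞} :
    edist f g ≤ c ↔ ∀ x, f.1 x ≤ g.1 x + c ∧ g.1 x ≤ f.1 x + c :=
  iSup_le_iff.trans (forall_congr' fun _ => halfLineDist_le_iff)

theorem isometry_toEnvelope (X : Type u) [PseudoEMetricSpace X] : Isometry (toEnvelope X) := by
  intro x y
  refine le_antisymm (edist_envelope_le_iff.2 fun z => ⟨?_, ?_⟩) ?_
  · rw [edist_comm x y]
    exact edist_triangle z y x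
  · exact edist_triangle z x y
  · have h := ((edist_envelope_le_iff (f := toEnvelope X x) (g := toEnvelope X y)).1 le_rfl x).2
    simpa [toEnvelope] using h

/-- Non-expanding maps of `ΔX` into itself that decrease every function. -/
def IsShrinking (r : {f : X → ℝ≥0∞ // InDelta X f} → {f : X → ℝ≥0∞ // InDelta X f}) : Prop :=
  (∀ f, r f ≤ f) ∧ ∀ f g (c : ℝ≥0∞), (∀ x, f.1 x ≤ g.1 x + c ∧ g.1 x ≤ f.1 x + c) →
    ∀ x, (r f).1 x ≤ (r g).1 x + c

open Classical in
/-- Lowering the value of `f ∈ ΔX` at the single point `x` as far as possible. -/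
noncomputable def lowerAt (x : X) (f : {f : X → ℝ≥0∞ // InDelta X f}) :
    {f : X → ℝ≥0∞ // InDelta X f} :=
  ⟨Function.update f.1 x (⨆ y, edist x y - f.1 y), by
    have key : ∀ y, edist x y ≤ (⨆ y, edist x y - f.1 y) + f.1 y := fun y =>
      tsub_le_iff_right.1 (le_iSup (fun y => edist x y - f.1 y) y)
    intro y z
    by_cases hy : y = x <;> by_cases hz : z = x
    · simp [hy, hz]
    · subst hy
      simpa [hz] using key z
    · subst hz
      simpa [hy, edist_comm, add_comm] using key y
    · simpa [hy, hz] using f.2 y z⟩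

theorem isShrinking_lowerAt (x : X) : IsShrinking (lowerAt x) := by
  classical
  constructor
  · intro f y
    by_cases hy : y = x
    · subst hy
      simpa [lowerAt] using fun z => f.2 y z
    · simp [lowerAt, hy]
  · intro f g c h y
    by_cases hy : y = x
    · subst hy
      simp only [lowerAt, Function.update_self]
      refine iSup_le fun z => tsub_le_iff_right.2 ?_
      calc edist y z ≤ (⨆ z, edist y z - g.1 z) + g.1 z :=
            tsub_le_iff_right.1 (le_iSup (fun z => edist y z - g.1 z) z)
        _ ≤ (⨆ z, edist y z - g.1 z) + (f.1 z + c) := by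
            gcongr
            exact (h z).2
        _ = _ := by ring
    · simpa [lowerAt, hy] using (h y).1

/-- There is a non-expanding retraction of `ΔX` onto the set of its minimal elements: a minimal
map among the decreasing non-expanding ones, which exists by Zorn's lemma, cannot be improved by
lowering its values at a point. -/
theorem exists_isShrinking_minimal (X : Type u) [PseudoEMetricSpace X] :
    ∃ r : {f : X → ℝ≥0∞ // InDelta X f} → {f : X → ℝ≥0∞ // InDelta X f},
      IsShrinking r ∧ ∀ f, Minimal (InDelta X) (r f).1 := by
  have hchain : ∀ C ⊆ {r | IsShrinking (X := X) r}, IsChain (· ≥ ·) C →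
      ∃ l ∈ {r | IsShrinking (X := X) r}, ∀ s ∈ C, l ≤ s := by
    intro C hC hCh
    rcases C.eq_empty_or_nonempty with rfl | ⟨s₀, hs₀⟩
    · exact ⟨id, ⟨fun f => le_rfl, fun f g c h x => (h x).1⟩, by simp⟩
    let l : {f : X → ℝ≥0∞ // InDelta X f} → {f : X → ℝ≥0∞ // InDelta X f} := fun f =>
      ⟨fun x => ⨅ s : C, (s.1 f).1 x, fun x y => ENNReal.le_iInf_add_iInf fun s t => by
        rcases hCh.total s.2 t.2 with hst | hst
        · exact ((t.1 f).2 x y).trans (add_le_add (hst f x) le_rfl)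
        · exact ((s.1 f).2 x y).trans (add_le_add le_rfl (hst f y))⟩
    have hl : ∀ s ∈ C, l ≤ s := fun s hs f x => iInf_le (fun s : C => (s.1 f).1 x) ⟨s, hs⟩
    refine ⟨l, ⟨fun f => (hl s₀ hs₀ f).trans ((hC hs₀).1 f), fun f g c h x => ?_⟩, hl⟩
    change (⨅ s : C, (s.1 f).1 x) ≤ (⨅ s : C, (s.1 g).1 x) + c
    rw [ENNReal.iInf_add]
    exact le_iInf fun s => (iInf_le _ s).trans ((hC s.2).2 f g c h x)
  obtain ⟨r, hr, hmin⟩ : ∃ r, IsShrinking (X := X) r ∧ ∀ s, IsShrinking s → s ≤ r → r ≤ s := by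
    obtain ⟨r, hr⟩ := zorn_le₀ (α := ({f : X → ℝ≥0∞ // InDelta X f} →
      {f : X → ℝ≥0∞ // InDelta X f})ᵒᵈ) {r | IsShrinking (X := X) r} hchain
    exact ⟨r, hr.1, fun s hs hsr => hr.2 hs hsr⟩
  refine ⟨r, hr, fun f => ⟨(r f).2, fun g hg hgr x => ?_⟩⟩
  have hcomp : IsShrinking (fun f => lowerAt x (r f)) :=
    ⟨fun f => ((isShrinking_lowerAt x).1 _).trans (hr.1 f), fun f g c h =>
      (isShrinking_lowerAt x).2 _ _ c fun y =>
        ⟨hr.2 f g c h y, hr.2 g f c (fun z => (h z).symm) y⟩⟩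
  refine (hmin _ hcomp (fun f => (isShrinking_lowerAt x).1 _) f x).trans ?_
  simp only [lowerAt, Function.update_self]
  refine iSup_le fun y => tsub_le_iff_right.2 ((hg x y).trans ?_)
  gcongr
  exact hgr y

/-- The injectivity of the space `EX`, for an arbitrary Lipschitz constant `K`: a map `φ : A → EX`
that is `K`-Lipschitz for the distance induced by `i : A → Y` extends to a `K`-Lipschitz map on
`Y`. The formula `y ↦ inf_a (φ(a) + K d(i(a), y))` gives an extension with values in `ΔX`, from
which one passes to `EX` by the retraction. -/
theorem exists_lipschitzWith_envelope {A Y : Type u} [PseudoEMetricSpace Y] (i : A → Y)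
    (φ : A → Envelope X) (K : ℝ≥0) (hφ : ∀ a a', edist (φ a) (φ a') ≤ K * edist (i a) (i a')) :
    ∃ g : Y → Envelope X, LipschitzWith K g ∧ ∀ a, g (i a) = φ a := by
  obtain ⟨r, hr, hrmin⟩ := exists_isShrinking_minimal X
  have hstep : ∀ a a' x, (φ a).1 x ≤ (φ a').1 x + K * edist (i a) (i a') := fun a a' x =>
    (edist_envelope_le_iff.1 (hφ a a') x).1
  have htri : ∀ y₁ y₂ y₃ : Y, (K : ℝ≥0∞) * edist y₁ y₃ ≤ K * edist y₁ y₂ + K * edist y₂ y₃ :=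
    fun y₁ y₂ y₃ => by
      rw [← mul_add]
      gcongr
      exact edist_triangle _ _ _
  let G : Y → {f : X → ℝ≥0∞ // InDelta X f} := fun y =>
    ⟨fun x => ⨅ a, (φ a).1 x + K * edist (i a) y, fun x x' =>
      ENNReal.le_iInf_add_iInf fun a a' => by
        calc edist x x' ≤ (φ a).1 x + (φ a).1 x' := (φ a).2.1 x x'
          _ ≤ (φ a).1 x + ((φ a').1 x' + (K * edist (i a) y + K * edist y (i a'))) := by
              gcongr
              exact (hstep a a' x').trans (by gcongr; exact htri _ _ _)
          _ = _ := by
              rw [edist_comm y]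
              ring⟩
  have hG : ∀ y y' x, (G y).1 x ≤ (G y').1 x + K * edist y y' := by
    intro y y' x
    change (⨅ a, _) ≤ (⨅ a, _) + _
    rw [ENNReal.iInf_add]
    refine le_iInf fun a => (iInf_le _ a).trans ?_
    rw [add_assoc, edist_comm y y']
    gcongr
    exact htri _ _ _
  refine ⟨fun y => ⟨(r (G y)).1, hrmin (G y)⟩, fun y y' => edist_envelope_le_iff.2 fun x => ?_,
    fun a => Subtype.ext ?_⟩
  · have h : ∀ y y' x, (r (G y)).1 x ≤ (r (G y')).1 x + K * edist y y' := fun y y' =>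
      hr.2 _ _ _ fun x => ⟨hG y y' x, edist_comm y y' ▸ hG y' y x⟩
    exact ⟨h y y' x, edist_comm y y' ▸ h y' y x⟩
  · have hle : (r (G (i a))).1 ≤ (φ a).1 := fun x =>
      (hr.1 _ x).trans ((iInf_le _ a).trans (by simp))
    exact le_antisymm hle ((φ a).2.2 (hrmin _).1 hle)

end Envelope

/-! ### Collapsing the components of a chain -/

section Collapse

/-- The distance as a function of unordered pairs. -/
noncomputable def edgeLength (Z : Type*) [PseudoEMetricSpace Z] : Sym2 Z → ℝ≥0∞ :=
  Sym2.lift ⟨edist, edist_comm⟩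

theorem edist_le_sum_edges {Z : Type*} [PseudoEMetricSpace Z] {G : SimpleGraph Z} {x y : Z}
    (w : G.Walk x y) : edist x y ≤ (w.edges.map (edgeLength Z)).sum := by
  induction w with
  | nil => simp
  | @cons x y z h w ih =>
    rw [SimpleGraph.Walk.edges_cons, List.map_cons, List.sum_cons]
    exact (edist_triangle x y z).trans (add_le_add le_rfl ih)

/-- A simple path uses every edge at most once, so that the diameters of the components of a graph
are bounded by the total length of its edges. -/
theorem edist_le_sum_of_reachable {Z : Type*} [PseudoEMetricSpace Z] {E : List (Sym2 Z)} {x y : Z}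
    (h : (SimpleGraph.fromEdgeSet {e | e ∈ E}).Reachable x y) :
    edist x y ≤ (E.map (edgeLength Z)).sum := by
  classical
  obtain ⟨w, hw⟩ := h.exists_isPath
  refine (edist_le_sum_edges w).trans ?_
  have hsub : w.edges ⊆ E := fun e he =>
    ((SimpleGraph.edgeSet_fromEdgeSet _).subset (w.edges_subset_edgeSet he)).1
  obtain ⟨l, hl, hlE⟩ := hw.isTrail.edges_nodup.subperm hsub
  rw [← (hl.map (edgeLength Z)).sum_eq]
  exact (hlE.map _).sum_le_sum fun _ _ => zero_le

variable {F : Type u ⥤ Type u} {X Z : Type u} [PseudoEMetricSpace X] [PseudoEMetricSpace Z]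

/-- A chain in `FZ` is trivialized by a map which is constant on the components of the graph formed
by all the pairs `f_i(k), g_i(k)`. The total length of this graph is the `ℓ^1`-length of the chain;
hence, if each component is sent to one of its points in the given set, every point of this set is
moved at most by the `ℓ^1`-length. -/
theorem IsLinkingChain.exists_collapse [Nonempty X] {e : X → Z} (he : Isometry e) {a b : F.obj Z}
    {L : List (Link F Z)} (hL : IsLinkingChain F a b L) (S : Set X) :
    ∃ h : Z → X, fmap F h a = fmap F h b ∧
      ∀ x ∈ S, h (e x) ∈ S ∧ edist x (h (e x)) ≤ (L.map (Link.cost 1)).sum := by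
  classical
  let E : List (Sym2 Z) := L.flatMap fun s => Finset.univ.toList.map fun i => s(s.f i, s.g i)
  have hE : (E.map (edgeLength Z)).sum = (L.map (Link.cost 1)).sum := by
    have hcost : ∀ s : Link F Z, s.cost 1 =
        ((Finset.univ.toList.map fun i => s(s.f i, s.g i)).map (edgeLength Z)).sum := fun s => by
      rw [Link.cost_one, List.map_map, Finset.sum_map_toList]
      rfl
    rw [List.map_flatMap, List.flatMap_def, List.sum_flatten, List.map_map]
    congr 1
    exact List.map_congr_left fun s _ => (hcost s).symm
  let G : SimpleGraph Z := SimpleGraph.fromEdgeSet {e | e ∈ E}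
  let rep : G.ConnectedComponent → X := fun c =>
    if H : ∃ x ∈ S, G.connectedComponentMk (e x) = c then H.choose else Classical.arbitrary X
  refine ⟨fun z => rep (G.connectedComponentMk z), hL.map_eq _ fun s hs => ?_, fun x hx => ?_⟩
  · rw [Link.src, Link.tgt, ← fmap_comp, ← fmap_comp]
    congr 1
    funext i
    congr 1
    refine SimpleGraph.ConnectedComponent.eq.2 ?_
    by_cases hi : s.f i = s.g i
    · rw [hi]
    · refine SimpleGraph.Adj.reachable ((SimpleGraph.fromEdgeSet_adj _).2 ⟨?_, hi⟩)
      exact List.mem_flatMap.2 ⟨s, hs, List.mem_map.2 ⟨i, by simp, rfl⟩⟩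
  · have H : ∃ y ∈ S, G.connectedComponentMk (e y) = G.connectedComponentMk (e x) := ⟨x, hx, rfl⟩
    simp only [rep, dif_pos H]
    refine ⟨H.choose_spec.1, ?_⟩
    rw [← he, ← hE]
    exact edist_le_sum_of_reachable (SimpleGraph.ConnectedComponent.eq.1 H.choose_spec.2.symm)

theorem einfsep_le_lpDist_one [Nonempty X] {e : X → Z} (he : Isometry e) {S : Set X}
    {a b : F.obj X} (ha : a ∈ imageOf F S) (hb : b ∈ imageOf F S) (hab : a ≠ b) :
    S.einfsep ≤ lpDist F 1 (fmap F e a) (fmap F e b) := by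
  refine le_iInf₂ fun L hL => ?_
  by_contra! hlt
  obtain ⟨h, hh, hS⟩ := hL.exists_collapse he S
  have hfix : ∀ x ∈ S, h (e x) = x := fun x hx => by
    by_contra hne
    exact absurd (Set.einfsep_le_edist_of_mem hx (hS x hx).1 (Ne.symm hne))
      (not_le.2 ((hS x hx).2.trans_lt hlt))
  rw [← fmap_comp, ← fmap_comp, fmap_eq_self_of_mem ha hfix, fmap_eq_self_of_mem hb hfix] at hh
  exact hab hh

theorem lpDist_top_fmap_self_le [HasFiniteSupports F] {k : X → X} {c : ℝ≥0∞}
    (hk : ∀ x, edist x (k x) ≤ c) (a : F.obj X) : lpDist F ⊤ a (fmap F k a) ≤ c := by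
  obtain ⟨n, j, d, rfl⟩ := exists_ord_map a
  rw [← fmap_comp]
  exact (lpDist_link_le ⊤ ⟨n, d, j, fun i => k (j i)⟩).trans (iSup_le fun i => hk (j i))

theorem lpDist_top_le_two_mul [HasFiniteSupports F] [Nonempty X] {e : X → Z} (he : Isometry e)
    (a b : F.obj X) :
    lpDist F ⊤ a b ≤ 2 * lpDist F 1 (fmap F e a) (fmap F e b) := by
  rw [lpDist.eq_1 F 1]
  simp only [iInf_subtype']
  rw [ENNReal.mul_iInf_of_ne (by simp) (by simp)]
  refine le_iInf fun ⟨L, hL⟩ => ?_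
  obtain ⟨h, hh, hS⟩ := hL.exists_collapse he Set.univ
  have hle : ∀ d : F.obj X, lpDist F ⊤ d (fmap F h (fmap F e d)) ≤ (L.map (Link.cost 1)).sum := by
    intro d
    rw [← fmap_comp]
    exact lpDist_top_fmap_self_le (fun x => (hS x trivial).2) d
  calc lpDist F ⊤ a b
      ≤ lpDist F ⊤ a (fmap F h (fmap F e a)) + lpDist F ⊤ (fmap F h (fmap F e a)) b :=
        lpDist_triangle ⊤ _ _ _
    _ ≤ (L.map (Link.cost 1)).sum + (L.map (Link.cost 1)).sum := by
        refine add_le_add (hle a) ?_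
        rw [hh]
        exact (lpDist_comm_le ⊤ _ _).trans (hle b)
    _ = _ := (two_mul _).symm

end Collapse

/-! ### Functors that preserve supports -/

section PreservesSupports

open Metric

variable {F : Type u ⥤ Type u} {X Z : Type u} [PseudoEMetricSpace X] [PseudoEMetricSpace Z]

theorem PreservesSupports.hausdorffEDist_src_tgt_le (hF : PreservesSupports F) (s : Link F Z) :
    hausdorffEDist (supp F s.src) (supp F s.tgt) ≤ s.cost ⊤ := by
  rw [Link.src, Link.tgt, hF, hF]
  have hle : ∀ i, edist (s.f i) (s.g i) ≤ s.cost ⊤ := le_iSup fun i => edist (s.f i) (s.g i)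
  refine hausdorffEDist_le_of_mem_edist ?_ ?_
  · rintro _ ⟨i, hi, rfl⟩
    exact ⟨_, ⟨i, hi, rfl⟩, hle i⟩
  · rintro _ ⟨i, hi, rfl⟩
    exact ⟨_, ⟨i, hi, rfl⟩, (edist_comm _ _).trans_le (hle i)⟩

theorem PreservesSupports.hausdorffEDist_chain_le (hF : PreservesSupports F) {a b : F.obj Z}
    {L : List (Link F Z)} (hL : IsLinkingChain F a b L) :
    hausdorffEDist (supp F a) (supp F b) ≤ (L.map (Link.cost ⊤)).sum ∧ ∀ s ∈ L,
      hausdorffEDist (supp F a) (supp F s.src) ≤ (L.map (Link.cost ⊤)).sum ∧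
      hausdorffEDist (supp F a) (supp F s.tgt) ≤ (L.map (Link.cost ⊤)).sum := by
  induction L generalizing a with
  | nil => exact absurd hL.head (by simp)
  | cons s L ih =>
    obtain ⟨rfl, hs⟩ := hL.cons_cases
    have hst := hF.hausdorffEDist_src_tgt_le s
    rw [List.map_cons, List.sum_cons]
    rcases hs with ⟨rfl, rfl⟩ | hs
    · simpa using hst
    · have step : ∀ {A : Set Z}, hausdorffEDist (supp F s.tgt) A ≤ (L.map (Link.cost ⊤)).sum →
          hausdorffEDist (supp F s.src) A ≤ s.cost ⊤ + (L.map (Link.cost ⊤)).sum := fun h =>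
        hausdorffEDist_triangle.trans (add_le_add hst h)
      obtain ⟨hb, hmem⟩ := ih hs
      refine ⟨step hb, fun t ht => ?_⟩
      rcases List.mem_cons.1 ht with rfl | ht
      · exact ⟨by simp, hst.trans le_self_add⟩
      · exact ⟨step (hmem t ht).1, step (hmem t ht).2⟩

theorem PreservesSupports.hausdorffEDist_le_lpDist (hF : PreservesSupports F) {e : X → Z}
    (he : Isometry e) (a b : F.obj X) :
    hausdorffEDist (supp F a) (supp F b) ≤ lpDist F ⊤ (fmap F e a) (fmap F e b) := by
  rw [← hausdorffEDist_image he, ← hF, ← hF]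
  exact le_iInf₂ fun L hL => (hF.hausdorffEDist_chain_le hL).1

/-- Along a chain that is shorter than a third of the separation of `S = supp a ∪ supp b`, the
supports stay so close to `S` that sending each point to the nearest point of `S` makes the chain
trivial. -/
theorem PreservesSupports.einfsep_div_three_le_lpDist [HasFiniteSupports F] [Nonempty X]
    (hF : PreservesSupports F) {e : X → Z} (he : Isometry e) {a b : F.obj X} (hab : a ≠ b) :
    (supp F a ∪ supp F b).einfsep / 3 ≤ lpDist F ⊤ (fmap F e a) (fmap F e b) := by
  classical
  refine le_iInf₂ fun L hL => ?_
  by_contra! hlt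
  set S := supp F a ∪ supp F b
  set r := S.einfsep / 3
  have hr : r + r + r = S.einfsep := ENNReal.add_thirds _
  have hr0 : 0 < r := zero_le.trans_lt hlt
  have hsep : ∀ x ∈ S, ∀ y ∈ S, edist x y < r + r + r → x = y := fun x hx y hy hxy => by
    by_contra hne
    exact absurd (Set.einfsep_le_edist_of_mem hx hy hne) (not_le.2 (hr ▸ hxy))
  let h : Z → X := fun z =>
    if H : ∃ x ∈ S, edist z (e x) < r then H.choose else Classical.arbitrary X
  have hspec : ∀ {z}, (∃ x ∈ S, edist z (e x) < r) → h z ∈ S ∧ edist z (e (h z)) < r := by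
    intro z H
    simp only [h, dif_pos H]
    exact H.choose_spec
  have hfix : ∀ x ∈ S, h (e x) = x := fun x hx => by
    obtain ⟨h1, h2⟩ := hspec (z := e x) ⟨x, hx, by simpa using hr0⟩
    rw [he] at h2
    exact (hsep x hx _ h1 (h2.trans_le (le_add_self))).symm
  have hnear : ∀ d : F.obj Z,
      hausdorffEDist (supp F (fmap F e a)) (supp F d) ≤ (L.map (Link.cost ⊤)).sum →
      ∀ z ∈ supp F d, ∃ x ∈ S, edist z (e x) < r := by
    intro d hd z hz
    rw [hausdorffEDist_comm] at hd
    obtain ⟨y, hy, hzy⟩ := exists_edist_lt_of_hausdorffEDist_lt hz (hd.trans_lt hlt)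
    rw [hF] at hy
    obtain ⟨x, hx, rfl⟩ := hy
    exact ⟨x, Or.inl hx, hzy⟩
  have hh : fmap F h (fmap F e a) = fmap F h (fmap F e b) := by
    refine hL.map_eq _ fun s hs => ?_
    obtain ⟨hsrc, htgt⟩ := (hF.hausdorffEDist_chain_le hL).2 s hs
    rw [Link.src, Link.tgt, ← fmap_comp, ← fmap_comp]
    refine fmap_congr_of_mem (hF.mem_imageOf_supp s.elt) fun i hi => ?_
    obtain ⟨f1, f2⟩ := hspec (hnear _ hsrc (s.f i) (by
      rw [Link.src, hF]; exact ⟨i, hi, rfl⟩))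
    obtain ⟨g1, g2⟩ := hspec (hnear _ htgt (s.g i) (by
      rw [Link.tgt, hF]; exact ⟨i, hi, rfl⟩))
    have hfg : edist (s.f i) (s.g i) < r :=
      (le_iSup (fun i => edist (s.f i) (s.g i)) i).trans_lt
        ((List.single_le_sum (fun _ _ => zero_le) (s.cost ⊤)
          (List.mem_map_of_mem hs)).trans_lt hlt)
    refine hsep _ f1 _ g1 ?_
    rw [← he]
    calc edist (e (h (s.f i))) (e (h (s.g i)))
        ≤ edist (e (h (s.f i))) (s.f i) + edist (s.f i) (s.g i) + edist (s.g i) (e (h (s.g i))) :=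
          edist_triangle4 _ _ _ _
      _ < r + r + r := by
          rw [edist_comm _ (s.f i)]
          exact ENNReal.add_lt_add (ENNReal.add_lt_add f2 hfg) g2
  rw [← fmap_comp, ← fmap_comp,
    fmap_eq_self_of_mem (hF.mem_imageOf_supp a) fun x hx => hfix x (Or.inl hx),
    fmap_eq_self_of_mem (hF.mem_imageOf_supp b) fun x hx => hfix x (Or.inr hx)] at hh
  exact hab hh

end PreservesSupports

/-! ### The modified distance -/

section CheckDist

variable {F : Type u ⥤ Type u} {X Y : Type u}

theorem fmap_xi (a : F.obj (FinOrd.{u} 1)) (k : X → Y) (x : X) :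
    fmap F k (xi F a X x) = xi F a Y (k x) :=
  (fmap_comp F k _ a).symm

theorem xi_injective {a : F.obj (FinOrd.{u} 1)}
    (ha : Function.Injective (xi F a (FinOrd.{u} 2))) (X : Type u) :
    Function.Injective (xi F a X) := by
  classical
  intro x y hxy
  by_contra hne
  let k : X → FinOrd.{u} 2 := fun z => if z = x then ⟨0⟩ else ⟨1⟩
  have h : xi F a _ (k x) = xi F a _ (k y) := by
    have h := congrArg (fmap F k) hxy
    rwa [fmap_xi, fmap_xi] at h
  have hk := ha h
  simp [k, Ne.symm hne] at hk

theorem supp_xi_subset (a : F.obj (FinOrd.{u} 1)) (x : X) : supp F (xi F a X x) ⊆ {x} :=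
  supp_subset_of_mem (mem_imageOf_of_forall_mem (A := {x}) (fun _ => Set.mem_singleton x) a)

/-- If `F` preserves supports and `supp a` were empty, then `a` would come from `F∅`, so that all
its images in `F2` would coincide. -/
theorem PreservesSupports.supp_xi [HasFiniteSupports F] (hF : PreservesSupports F)
    {a : F.obj (FinOrd.{u} 1)} (ha : Function.Injective (xi F a (FinOrd.{u} 2))) (x : X) :
    supp F (xi F a X x) = {x} := by
  have hne : (supp F a).Nonempty := by
    rw [Set.nonempty_iff_ne_empty]
    intro h
    have hmem := hF.mem_imageOf_supp a
    rw [h] at hmem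
    have heq : xi F a (FinOrd.{u} 2) ⟨0⟩ = xi F a (FinOrd.{u} 2) ⟨1⟩ :=
      fmap_congr_of_mem hmem fun _ hi => hi.elim
    simpa using ha heq
  rw [xi, hF, hne.image_const]

variable [PseudoEMetricSpace X] [PseudoEMetricSpace Y]

theorem lpDist_xi_le (p : ℝ≥0∞) [Fact (1 ≤ p)] (a : F.obj (FinOrd.{u} 1)) (x y : X) :
    lpDist F p (xi F a X x) (xi F a X y) ≤ edist x y := by
  refine (lpDist_link_le p ⟨1, a, fun _ => x, fun _ => y⟩).trans
    ((Link.cost_le_cost_one p _).trans ?_)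
  simp [Link.cost_one]

theorem checkDist_le_lpDist (p : ℝ≥0∞) [Fact (1 ≤ p)] (a b : F.obj X) :
    checkDist F p a b ≤ lpDist F p a b :=
  lpDist_fmap_le_of_lipschitzWith_one p (isometry_toEnvelope X).lipschitz a b

theorem checkDist_fmap_le (p : ℝ≥0∞) [Fact (1 ≤ p)] {K : ℝ≥0} (hK : K ≠ 0) {f : X → Y}
    (hf : LipschitzWith K f) (a b : F.obj X) :
    checkDist F p (fmap F f a) (fmap F f b) ≤ K * checkDist F p a b := by
  obtain ⟨g, hg, hgf⟩ := exists_lipschitzWith_envelope (toEnvelope X)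
    (fun x => toEnvelope Y (f x)) K fun x y => by
      rw [isometry_toEnvelope, isometry_toEnvelope]
      exact hf x y
  have h : ∀ c : F.obj X,
      fmap F (toEnvelope Y) (fmap F f c) = fmap F g (fmap F (toEnvelope X) c) := fun c => by
    rw [← fmap_comp, ← fmap_comp, funext hgf]
  rw [checkDist, checkDist, h, h]
  exact lpDist_fmap_le p hK hg _ _

theorem checkDist_fmap_of_isometry (p : ℝ≥0∞) [Fact (1 ≤ p)] {f : X → Y} (hf : Isometry f)
    (a b : F.obj X) : checkDist F p (fmap F f a) (fmap F f b) = checkDist F p a b := by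
  refine le_antisymm (by simpa using checkDist_fmap_le p one_ne_zero hf.lipschitz a b) ?_
  obtain ⟨g, hg, hgf⟩ := exists_lipschitzWith_envelope (fun x => toEnvelope Y (f x))
    (toEnvelope X) 1 fun x y => by
      rw [isometry_toEnvelope, isometry_toEnvelope, hf]
      simp
  have h : ∀ c : F.obj X,
      fmap F (toEnvelope X) c = fmap F g (fmap F (toEnvelope Y) (fmap F f c)) := fun c => by
    rw [← fmap_comp, ← fmap_comp, funext hgf]
  rw [checkDist, h a, h b]
  exact lpDist_fmap_le_of_lipschitzWith_one p hg _ _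

theorem checkDist_eq_lpDist (p : ℝ≥0∞) [Fact (1 ≤ p)] (hX : IsInjectiveSpace X) (a b : F.obj X) :
    checkDist F p a b = lpDist F p a b := by
  refine le_antisymm (checkDist_le_lpDist p a b) ?_
  obtain ⟨g, hg, hgi⟩ := hX _ (toEnvelope X) (isometry_toEnvelope X)
  have h := lpDist_fmap_le_of_lipschitzWith_one p hg (fmap F (toEnvelope X) a)
    (fmap F (toEnvelope X) b)
  rwa [fmap_leftInverse hgi, fmap_leftInverse hgi] at h

theorem checkDist_top_le (p : ℝ≥0∞) [Fact (1 ≤ p)] (a b : F.obj X) :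
    checkDist F ⊤ a b ≤ checkDist F p a b :=
  lpDist_top_le p _ _

variable [HasFiniteSupports F]

theorem lpDist_lt_top (p : ℝ≥0∞) [Fact (1 ≤ p)] [Nonempty X] (hX : IsPseudometric X)
    (h1 : PreservesSingletons F) (a b : F.obj X) : lpDist F p a b < ⊤ := by
  obtain ⟨x⟩ := ‹Nonempty X›
  obtain ⟨h1⟩ := h1
  have key : ∀ c : F.obj X, lpDist F p c (xi F h1.default X x) < ⊤ := by
    intro c
    obtain ⟨n, j, d, rfl⟩ := exists_ord_map c
    have htgt : (⟨n, d, j, fun _ => x⟩ : Link F X).tgt = xi F h1.default X x := by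
      rw [Link.tgt, xi, ← h1.uniq (fmap F (fun _ => ⟨0⟩) d), ← fmap_comp]
    rw [← htgt]
    refine (lpDist_link_le p ⟨n, d, j, fun _ => x⟩).trans_lt
      ((Link.cost_le_cost_one p _).trans_lt ?_)
    rw [Link.cost_one]
    exact ENNReal.sum_lt_top.2 fun i _ => hX _ _
  calc lpDist F p a b ≤ lpDist F p a (xi F h1.default X x) + lpDist F p (xi F h1.default X x) b :=
        lpDist_triangle p _ _ _
    _ < ⊤ := ENNReal.add_lt_top.2 ⟨key a, (lpDist_comm_le p _ _).trans_lt (key b)⟩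

theorem einfsep_supp_pos (hX : IsInftyMetric X) (a b : F.obj X) :
    0 < (supp F a ∪ supp F b).einfsep := by
  have hfin : (supp F a ∪ supp F b).Finite := (finite_supp a).union (finite_supp b)
  rw [hfin.einfsep, Finset.lt_inf_iff ENNReal.zero_lt_top]
  rintro ⟨x, y⟩ hxy
  exact hX x y (by simpa using (Set.mem_offDiag.1 (hfin.offDiag.mem_toFinset.1 hxy)).2.2)

theorem checkDist_one_le (hF : HasFiniteDegree F) (a b : F.obj X) :
    checkDist F 1 a b ≤ degOne F * checkDist F ⊤ a b := by
  simpa [checkDist] using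
    lpDist_le_mul_lpDist_top hF 1 (fmap F (toEnvelope X) a) (fmap F (toEnvelope X) b)

variable [Nonempty X]

theorem einfsep_le_checkDist_one {a b : F.obj X} (hab : a ≠ b) :
    (supp F a ∪ supp F b).einfsep ≤ checkDist F 1 a b := by
  obtain ⟨S, ha, hb, hS⟩ := exists_mem_imageOf_einfsep a b
  rw [← hS]
  exact einfsep_le_lpDist_one (isometry_toEnvelope X) ha hb hab

theorem checkDist_eq_top (p : ℝ≥0∞) [Fact (1 ≤ p)] {a b : F.obj X} (hab : a ≠ b)
    (h : (supp F a ∪ supp F b).einfsep = ⊤) : checkDist F p a b = ⊤ := by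
  refine top_le_iff.1 (le_trans ?_ (checkDist_top_le p a b))
  exact (lpDist_top_eq_top (top_le_iff.1 (h ▸ einfsep_le_checkDist_one hab))).ge

theorem checkDist_pos (p : ℝ≥0∞) [Fact (1 ≤ p)] (hX : IsInftyMetric X)
    (h : p = 1 ∨ HasFiniteDegree F ∨ PreservesSupports F) {a b : F.obj X} (hab : a ≠ b) :
    0 < checkDist F p a b := by
  have h1 : 0 < checkDist F 1 a b :=
    (einfsep_supp_pos hX a b).trans_le (einfsep_le_checkDist_one hab)
  rcases h with rfl | hF | hF
  · exact h1
  · refine lt_of_lt_of_le ?_ (checkDist_top_le p a b)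
    by_contra! h0
    have hle := checkDist_one_le hF a b
    rw [nonpos_iff_eq_zero.1 h0, mul_zero] at hle
    exact absurd h1 (not_lt.2 hle)
  · refine lt_of_lt_of_le ?_ (checkDist_top_le p a b)
    refine lt_of_lt_of_le ?_ (hF.einfsep_div_three_le_lpDist (isometry_toEnvelope X) hab)
    exact ENNReal.div_pos (einfsep_supp_pos hX a b).ne' (by simp)

theorem checkDist_xi (p : ℝ≥0∞) [Fact (1 ≤ p)] {a : F.obj (FinOrd.{u} 1)}
    (ha : Function.Injective (xi F a (FinOrd.{u} 2))) (h : p = 1 ∨ PreservesSupports F) (x y : X) :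
    checkDist F p (xi F a X x) (xi F a X y) = edist x y := by
  refine le_antisymm ((checkDist_le_lpDist p _ _).trans (lpDist_xi_le p a x y)) ?_
  by_cases hxy : x = y
  · simp [hxy]
  rcases h with rfl | hF
  · refine le_trans ?_ (einfsep_le_checkDist_one ((xi_injective ha X).ne hxy))
    rw [← Set.einfsep_pair hxy]
    refine Set.einfsep_anti (Set.union_subset ?_ ?_)
    · exact (supp_xi_subset a x).trans (by simp)
    · exact (supp_xi_subset a y).trans (by simp)
  · refine le_trans ?_ (checkDist_top_le p _ _)
    have hle := hF.hausdorffEDist_le_lpDist (isometry_toEnvelope X) (xi F a X x) (xi F a X y)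
    rwa [hF.supp_xi ha, hF.supp_xi ha, Metric.hausdorffEDist_singleton] at hle

/-- The factor `|Fn|` absorbs the constant `2` coming from the collapse of chains, unless `Fn` has at
most one element. In this case all elements of `FX` are of the form `ξ(x)` with the same `ξ`, which
is either constant or an isometry. -/
theorem lpDist_top_le_mul_checkDist (hF : HasFiniteDegree F) (a b : F.obj X) :
    lpDist F ⊤ a b ≤ (degOne F : ℝ≥0∞) *
      (ENat.card (F.obj (FinOrd.{u} (degOne F))) : ℝ≥0∞) * checkDist F ⊤ a b := by
  rcases subsingleton_or_nontrivial (F.obj (FinOrd.{u} (degOne F))) with hs | hs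
  · have : Nonempty (FinOrd.{u} (degOne F)) := ⟨⟨⟨0, by simp [degOne]⟩⟩⟩
    obtain ⟨i⟩ := this
    obtain ⟨f, c, rfl⟩ := exists_degOne_map hF a
    obtain ⟨g, d, rfl⟩ := exists_degOne_map hF b
    obtain rfl : c = d := Subsingleton.elim _ _
    have hc : fmap F (fun _ => i) (fmap F (fun _ => (⟨0⟩ : FinOrd.{u} 1)) c) = c :=
      Subsingleton.elim _ _
    set c₁ := fmap F (fun _ => (⟨0⟩ : FinOrd.{u} 1)) c
    have hxi : ∀ k : FinOrd.{u} (degOne F) → X, fmap F k c = xi F c₁ X (k i) := fun k => by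
      rw [← hc, ← fmap_comp, xi]
    have hcard : ENat.card (F.obj (FinOrd.{u} (degOne F))) = 1 :=
      ENat.card_eq_one_iff_unique.2 ⟨⟨⟨c⟩, fun _ => Subsingleton.elim _ _⟩⟩
    rw [hxi f, hxi g, hcard, ENat.toENNReal_one, mul_one]
    by_cases ha : Function.Injective (xi F c₁ (FinOrd.{u} 2))
    · calc _ ≤ edist (f i) (g i) := lpDist_xi_le ⊤ c₁ _ _
        _ = checkDist F 1 (xi F c₁ X (f i)) (xi F c₁ X (g i)) :=
          (checkDist_xi 1 ha (Or.inl rfl) _ _).symm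
        _ ≤ _ := checkDist_one_le hF _ _
    · have heq : xi F c₁ (FinOrd.{u} 2) ⟨0⟩ = xi F c₁ (FinOrd.{u} 2) ⟨1⟩ := by
        by_contra hne
        refine ha fun ⟨k⟩ ⟨l⟩ hkl => ?_
        fin_cases k <;> fin_cases l
        · rfl
        · exact absurd hkl hne
        · exact absurd hkl.symm hne
        · rfl
      have h := congrArg (fmap F fun k : FinOrd.{u} 2 => if k = ⟨0⟩ then f i else g i) heq
      rw [fmap_xi, fmap_xi, if_pos rfl, if_neg (by simp)] at h
      rw [h, lpDist_self]
      exact zero_le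
  · have h2 : (2 : ℝ≥0∞) ≤ (ENat.card (F.obj (FinOrd.{u} (degOne F))) : ℝ≥0∞) := by
      have h : (2 : ℕ∞) ≤ ENat.card (F.obj (FinOrd.{u} (degOne F))) := by
        rw [← one_add_one_eq_two]
        exact Order.add_one_le_of_lt ENat.one_lt_card
      exact_mod_cast ENat.toENNReal_le.2 h
    calc lpDist F ⊤ a b ≤ 2 * checkDist F 1 a b := lpDist_top_le_two_mul (isometry_toEnvelope X) a b
      _ ≤ ENat.card (F.obj (FinOrd.{u} (degOne F))) * (degOne F * checkDist F ⊤ a b) :=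
        mul_le_mul' h2 (checkDist_one_le hF a b)
      _ = _ := by ring

end CheckDist

end SetFunctor

theorem theoremt (F : Type u ⥤ Type u) [HasFiniteSupports F] (p : ℝ≥0∞) [Fact (1 ≤ p)] :
    (∀ (X : Type u) [PseudoEMetricSpace X] [Nonempty X],
      -- distinct elements with small supports
      (∀ a b : F.obj X, a ≠ b → (supp F a ∪ supp F b).encard ≤ 1 → checkDist F p a b = ⊤) ∧
      -- comparison of the modified distances for different exponents
      (∀ a b : F.obj X, checkDist F ⊤ a b ≤ checkDist F p a b) ∧
      (∀ a b : F.obj X, checkDist F p a b ≤ checkDist F 1 a b) ∧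
      (HasFiniteDegree F → ∀ a b : F.obj X,
        checkDist F p a b ≤ (degOne F : ℝ≥0∞) ^ (1 / p).toReal * checkDist F ⊤ a b) ∧
      -- comparison of the modified distance with the original one
      (∀ a b : F.obj X, checkDist F p a b ≤ lpDist F p a b) ∧
      (HasFiniteDegree F → ∀ a b : F.obj X,
        lpDist F ⊤ a b ≤
          (degOne F : ℝ≥0∞) * (ENat.card (F.obj (FinOrd.{u} (degOne F))) : ℝ≥0∞)
            * checkDist F ⊤ a b) ∧
      (IsInjectiveSpace X → ∀ a b : F.obj X, checkDist F p a b = lpDist F p a b) ∧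
      -- pseudometrics
      (IsPseudometric X → PreservesSingletons F → IsPseudometric (CheckLp F p X)) ∧
      -- lower bounds
      (∀ a b : F.obj X, a ≠ b → (supp F a ∪ supp F b).einfsep ≤ checkDist F 1 a b) ∧
      (PreservesSupports F → ∀ a b : F.obj X, a ≠ b →
        checkDist F ⊤ a b ≤ checkDist F p a b ∧
        max (Metric.hausdorffEDist (supp F a) (supp F b)) ((supp F a ∪ supp F b).einfsep / 3)
          ≤ checkDist F ⊤ a b) ∧
      -- `∞`-metrics and metrics
      (IsInftyMetric X → IsInftyMetric (LpSpace F p (Envelope X)) → IsInftyMetric (CheckLp F p X)) ∧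
      (IsInftyMetric X → (p = 1 ∨ HasFiniteDegree F ∨ PreservesSupports F) →
        IsInftyMetric (CheckLp F p X)) ∧
      (IsMetric X → PreservesSingletons F → (p = 1 ∨ HasFiniteDegree F ∨ PreservesSupports F) →
        IsMetric (CheckLp F p X)) ∧
      -- the canonical maps `X → FX`
      (∀ a : F.obj (FinOrd.{u} 1), Function.Injective (xi F a (FinOrd.{u} 2)) →
        (p = 1 ∨ PreservesSupports F) →
        Function.Injective (xi F a X) ∧ Isometry (α := X) (β := CheckLp F p X) (xi F a X)) ∧
      -- the `{0,∞}`-valued `∞`-metric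
      (IsZeroInftyMetric X → IsZeroInftyMetric (CheckLp F p X))) ∧
    -- preservation of Lipschitz maps
    (∀ (X Y : Type u) [PseudoEMetricSpace X] [PseudoEMetricSpace Y] (f : X → Y),
      IsLipschitz f →
        IsLipschitz (CheckLp.map F p f) ∧ lipConst (CheckLp.map F p f) ≤ lipConst f) ∧
    -- preservation of isometries
    (∀ (X Y : Type u) [PseudoEMetricSpace X] [PseudoEMetricSpace Y] (f : X → Y),
      Isometry f → Isometry (CheckLp.map F p f)) := by
  refine ⟨fun X _ _ => ⟨fun a b hab h => ?_, checkDist_top_le p, fun a b => lpDist_le_one p _ _,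
    fun hF a b => lpDist_le_mul_lpDist_top hF p _ _, checkDist_le_lpDist p,
    fun hF => lpDist_top_le_mul_checkDist hF, checkDist_eq_lpDist p, fun hX h1 a b => ?_,
    fun a b => einfsep_le_checkDist_one, fun hF a b hab => ⟨checkDist_top_le p a b, max_le
      (hF.hausdorffEDist_le_lpDist (isometry_toEnvelope X) a b)
      (hF.einfsep_div_three_le_lpDist (isometry_toEnvelope X) hab)⟩,
    fun hX hE a b hab => ?_, fun hX h a b => checkDist_pos p hX h, fun hX h1 h => ⟨fun a b => ?_,
      fun a b => checkDist_pos p hX.2 h⟩, fun a ha h => ⟨xi_injective ha X, checkDist_xi p ha h⟩,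
    fun hX a b hab => ?_⟩, fun X Y _ _ f hf => ?_,
    fun X Y _ _ f hf => checkDist_fmap_of_isometry p hf⟩
  · exact checkDist_eq_top p hab (Set.encard_le_one_iff_subsingleton.1 h).einfsep
  · exact (checkDist_le_lpDist p _ _).trans_lt (lpDist_lt_top p hX h1 _ _)
  · have he : Function.Injective (toEnvelope X) := fun x y hxy => by
      by_contra hne
      have hpos := hX x y hne
      rw [← isometry_toEnvelope X x y, hxy, edist_self] at hpos
      exact lt_irrefl _ hpos
    exact hE _ _ ((fmap_injective he).ne hab)
  · exact (checkDist_le_lpDist p _ _).trans_lt (lpDist_lt_top p hX.1 h1 _ _)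
  · refine checkDist_eq_top p hab (top_le_iff.1 (Set.le_einfsep fun x _ y _ hxy => ?_))
    exact (hX x y hxy).ge
  · -- The constant `0` does not pass from `f` to `Ff`: elements at distance `∞` that no chain links
    -- may have distinct images under `Ff` at distance `∞`, whereas `0 * ∞ = 0`.
    have key : ∀ K : ℝ≥0, K ≠ 0 → LipschitzWith K f → LipschitzWith K (CheckLp.map F p f) :=
      fun K hK hKf a b => checkDist_fmap_le p hK hKf a b
    have hlt : ∀ K : ℝ≥0, lipConst f < K → LipschitzWith K (CheckLp.map F p f) := fun K hK => by
      obtain ⟨K', hK'f, hK'⟩ := exists_lt_of_csInf_lt hf hK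
      exact key K (zero_le.trans_lt hK).ne' (LipschitzWith.weaken hK'f hK'.le)
    refine ⟨⟨lipConst f + 1, hlt _ (lt_add_one _)⟩, le_of_forall_gt_imp_ge_of_dense fun K hK => ?_⟩
    exact csInf_le (OrderBot.bddBelow _) (hlt K hK)
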